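/- For a partition $\lambda$ of $m\ge 1$, let $N(\lambda)$ be its number of parts, i.e. the number of rows of its Young diagram. Consider the following random moves between partitions (Young diagrams), where $0<\mu<1$. * Up rule $\mathrm{ROW}(\mu)$: with probability $\mu$ create a new row of length $1$; otherwise choose one of the $N(\lambda)$ rows uniformly at random and, if $\kappa$ is its length, insert a square at the inner corner belonging to the rows of length $\kappa$ (one part $\kappa$ is replaced by $\kappa+1$). * Down rule $\mathrm{DEROW}$: choose one of the $N(\lambda)$ rows uniformly at random and, if $\kappa$ is its length, remove the outer corner belonging to the rows of length $\kappa$ (one part $\kappa$ is replaced by $\kappa-1$, and disappears if $\kappa=1$). Let $\mathcal P_n$ be the set of partitions of $n$. For $n\ge2$, the up-and-down process $\mathrm{DEROW}\text{-}\mathrm{ROW}(\mu)$ is the Markov chain on $\mathcal P_{n-1}\cup\mathcal P_n$ that moves by $\mathrm{ROW}(\mu)$ from $\mathcal P_{n-1}$ to $\mathcal P_n$ and by $\mathrm{DEROW}$ from $\mathcal P_n$ to $\mathcal P_{n-1}$. Observed on $\mathcal P_n$ only, it is the Markov chain on $\mathcal P_n$ each step of which is a $\mathrm{DEROW}$ step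 followed by a $\mathrm{ROW}(\mu)$ step. For a scaling factor $a>0$ and a partition $\lambda$ of $m$, rescale the Young diagram by multiplying row lengths by $1/a$ and column heights by $a/m$, so that its area is $1$; its boundary function is $$\partial^{a}\lambda(x)=\frac{a}{m}\,\#\{i:\lambda_i\ge a x\},\qquad x\ge0 .$$ A sequence of probability distributions $\pi_n$ on finite sets of partitions has the limit shape $y$ under the scaling $a_n$ if for every $\varepsilon>0$ $$\lim_{n\to\infty}\pi_n\Bigl\{\lambda:\ |\partial^{a_n}\lambda(x)-y(x)|<\varepsilon\ \text{ for all } x\ge 0\Bigr\}=1 .$$ **Theorem.** Let $(\mu_n)$ be real numbers with $0<\mu_n<1$ for $n\ge 2$, such that $\mu_n\log(\mu_n n)\to0$ and $\mu_n n\to\infty$ as $n\to\infty$, and let $a_n=1/\mu_n$. For every $n\ge2$, the process $\mathrm{DEROW}\text{-}\mathrm{ROW}(\mu_n)$ has a unique stationary distribution, both as a chain on $\mathcal P_n$ and as a chain on $\mathcal P_{n-1}\cup\mathcal P_n$, and in both cases the sequence of stationary distributions has, under the scaling $a_n$, the limit shape $$y(x)=e^{-x}.$$ -/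

import Mathlib

open Filter Topology

noncomputable section

/-- The transition probability `p → q` of the up rule `ROW(μ)`, for partitions `p` of `n` and `q` of
`m` (it vanishes unless `m = n + 1`).  With probability `μ` a new part `1` is created; otherwise one
of the parts of `p` is chosen uniformly at random (parts counted with multiplicity) and, `κ` being
its size, a square is inserted at the inner corner of the rows of length `κ`, that is, one part `κ`
is replaced by `κ + 1`. -/
def rowRule (μ : ℝ) {n m : ℕ} (p : n.Partition) (q : m.Partition) : ℝ :=
  μ * (if q.parts = 1 ::ₘ p.parts then 1 else 0) +
    (1 - μ) *
      ((p.parts.countP fun κ => q.parts = (κ + 1) ::ₘ p.parts.erase κ) / p.parts.card)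

/-- The transition probability `p → q` of the down rule `DEROW`, for partitions `p` of `n` and `q` of
`m` (it vanishes unless `n = m + 1`).  One of the parts of `p` is chosen uniformly at random (parts
counted with multiplicity) and, `κ` being its size, the outer corner of the rows of length `κ` is
removed, that is, one part `κ` is replaced by `κ - 1` (and disappears if `κ = 1`). -/
def derowRule {n m : ℕ} (p : n.Partition) (q : m.Partition) : ℝ :=
  (p.parts.countP fun κ => q.parts = ((κ - 1) ::ₘ p.parts.erase κ).filter (fun k => k ≠ 0)) /
    p.parts.card

/-- The transition matrix of the up-and-down chain with up rule `U` and down rule `D` on two adjacent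
levels `A` (lower) and `B` (upper): from a state in `A` it moves up by `U`, from a state in `B` it
moves down by `D`. -/
def upDownMatrix {A B : Type*} (U : A → B → ℝ) (D : B → A → ℝ) : Matrix (A ⊕ B) (A ⊕ B) ℝ :=
  Matrix.fromBlocks 0 (Matrix.of U) (Matrix.of D) 0

/-- The up-and-down chain `DEROW-ROW(μ)` on the levels `n - 1` and `n` of Young's lattice, toggling
between the two levels (for `2 ≤ n`). -/
def derowRowToggle (μ : ℝ) (n : ℕ) :
    Matrix ((n - 1).Partition ⊕ n.Partition) ((n - 1).Partition ⊕ n.Partition) ℝ :=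
  upDownMatrix (rowRule μ) derowRule

/-- The chain `DEROW-ROW(μ)` observed on the partitions of `n` only (for `2 ≤ n`): one step is a
`DEROW` step followed by a `ROW(μ)` step. -/
def derowRow (μ : ℝ) (n : ℕ) : Matrix n.Partition n.Partition ℝ :=
  (Matrix.of derowRule : Matrix n.Partition (n - 1).Partition ℝ) *
    (Matrix.of (rowRule μ) : Matrix (n - 1).Partition n.Partition ℝ)

/-- `π` is a stationary distribution of the finite Markov chain with transition matrix `K`. -/
def IsStationaryDistribution {S : Type*} [Fintype S] (K : Matrix S S ℝ) (π : S → ℝ) : Prop :=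
  π ∈ stdSimplex ℝ S ∧ Matrix.vecMul π K = π

/-- The boundary function of the Young diagram of a partition `p` of `m`, rescaled by the scaling
factor `a`: row lengths are multiplied by `1 / a` and column heights by `a / m`, so that the area is
`1`.  The height of the diagram of `p` above the abscissa `t` is the number of parts `≥ t`. -/
def scaledBoundary (a : ℝ) {m : ℕ} (p : m.Partition) (x : ℝ) : ℝ :=
  a / m * (p.parts.countP fun k => a * x ≤ (k : ℝ))

open Classical in
/-- Let `π n` be a probability distribution on the finite set `S n`, and let the state `s : S n` have
the rescaled boundary function `f n s`.  The sequence has limit shape `y` if the rescaled boundary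
function converges to `y` in probability, uniformly on `[0, ∞)`. -/
def HasLimitShape {S : ℕ → Type*} [∀ n, Fintype (S n)] (π : ∀ n, S n → ℝ)
    (f : ∀ n, S n → ℝ → ℝ) (y : ℝ → ℝ) : Prop :=
  ∀ ε : ℝ, 0 < ε →
    Tendsto (fun n => ∑ s with ∀ x : ℝ, 0 ≤ x → |f n s x - y x| < ε, π n s) atTop (𝓝 1)

end

/-! The stationary law is explicit. Cut a segment of length `n` at each of its `n - 1` inner places
independently with probability `μ`: a composition with `k` blocks has probability `μ ^ (k - 1) * (1
- μ) ^ (n - k)`, and `cutWeight` sums this over the arrangements of a partition. The weights on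
adjacent levels satisfy detailed balance between `ROW(μ)` and `DEROW` (`cutWeight_mul_rowRule`), so
they are carried into each other and are stationary. Uniqueness follows from the maximum principle,
since squares can be moved into new rows until all parts are `1`.

For the shape, lengthening a marked row by one square multiplies its weight by `1 - μ`
(`cutMean_sum_map_erase_succ`). The number of rows of length at least `u + 1` thus has mean `(1 - μ)
^ u * (1 + (n - u - 1) * μ)` for `u < n`, and pairs of rows give a second moment close to the square
of this mean. With `u * μ` near `x`, `μ → 0` and `μ * n → ∞`, the rescaled count tends to `exp (-x)`
in mean square. Chebyshev's inequality at finitely many grid points and monotonicity make the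
convergence uniform. -/

/-! ### Arrangements of a multiset and counting parts. -/

/-- Double counting of arrangements with one marked copy of `a`: deleting the mark leaves an
arrangement of `s` and one of `s.card + 1` insertion places. -/
theorem Multiset.count_mul_countPerms_cons {α : Type*} [DecidableEq α] (a : α) (s : Multiset α) :
    (a ::ₘ s).count a * (a ::ₘ s).countPerms = (s.card + 1) * s.countPerms := by
  rw [Multiset.countPerms_filter_ne a (a ::ₘ s), Multiset.countPerms_filter_ne a s,
    Multiset.count_cons_self, Multiset.card_cons, Multiset.filter_cons_of_neg _ (by simp),
    ← mul_assoc, ← mul_assoc, Nat.add_one_mul_choose_eq, mul_comm (s.count a + 1)]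

theorem Multiset.countPerms_pos {α : Type*} [DecidableEq α] (s : Multiset α) :
    0 < s.countPerms := by
  induction s using Multiset.induction_on with
  | empty => simp
  | cons a s ih =>
    have h := Multiset.count_mul_countPerms_cons a s
    by_contra h0
    rw [Nat.eq_zero_of_not_pos h0, mul_zero] at h
    exact (Nat.mul_pos s.card.succ_pos ih).ne h

theorem Multiset.countP_eq_count_of_iff {α : Type*} [DecidableEq α] {P : α → Prop}
    [DecidablePred P] {s : Multiset α} {a : α} (h : ∀ x ∈ s, P x ↔ x = a) :
    s.countP P = s.count a := by
  rw [Multiset.count]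
  exact Multiset.countP_congr rfl fun x hx => by rw [h x hx, eq_comm (a := a)]

theorem Multiset.natCast_countP {α : Type*} (P : α → Prop) [DecidablePred P] (s : Multiset α) :
    (s.countP P : ℝ) = (s.map fun x => if P x then (1 : ℝ) else 0).sum := by
  induction s using Multiset.induction_on with
  | empty => simp
  | cons a s ih => by_cases h : P a <;> simp [h, ih, add_comm]

theorem Nat.Partition.card_parts_pos {n : ℕ} (hn : 1 ≤ n) (p : n.Partition) :
    0 < p.parts.card := by
  rw [Multiset.card_pos]
  intro h
  have := p.parts_sum
  simp [h] at this
  omega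

/-! ### The cut weight and detailed balance between adjacent levels. -/

/-- The probability of the partition `p` of `n` under the law of the block sizes of the random
composition of `n` that is cut at each of the `n - 1` inner places independently with
probability `μ`. -/
noncomputable def cutWeight (μ : ℝ) {n : ℕ} (p : n.Partition) : ℝ :=
  p.parts.countPerms * (μ / (1 - μ)) ^ p.parts.card * (1 - μ) ^ n / μ

theorem cutWeight_pos {μ : ℝ} (h0 : 0 < μ) (h1 : μ < 1) {n : ℕ} (p : n.Partition) :
    0 < cutWeight μ p := by
  have h2 : 0 < 1 - μ := by linarith
  have h3 : (0 : ℝ) < p.parts.countPerms := by exact_mod_cast p.parts.countPerms_pos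
  unfold cutWeight
  positivity

/-- Moving a square from level `n` to level `n + 1` on top of a row of length `κ`. -/
theorem count_mul_cutWeight_succ {μ : ℝ} {n m : ℕ} (hm : n + 1 = m)
    (p : n.Partition) (q : m.Partition) (s : Multiset ℕ) (κ : ℕ) (hp : p.parts = κ ::ₘ s)
    (hq : q.parts = (κ + 1) ::ₘ s) :
    q.parts.count (κ + 1) * cutWeight μ q = (1 - μ) * (p.parts.count κ * cutWeight μ p) := by
  -- Both sides equal `(s.card + 1) * s.countPerms`.
  have hA : (q.parts.count (κ + 1) * q.parts.countPerms : ℝ) =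
      p.parts.count κ * p.parts.countPerms := by
    rw [hp, hq]
    exact_mod_cast (Multiset.count_mul_countPerms_cons _ s).trans
      (Multiset.count_mul_countPerms_cons _ s).symm
  have hc : q.parts.card = p.parts.card := by simp [hp, hq]
  unfold cutWeight
  subst hm
  rw [hc, pow_succ]
  linear_combination (μ / (1 - μ)) ^ p.parts.card * (1 - μ) ^ n * (1 - μ) / μ * hA

/-- A new row contributes `μ / (1 - μ)` and the higher level `1 - μ`, hence the factor `μ`; the new
`1` can be inserted at `p.parts.card + 1` places. -/
theorem count_one_mul_cutWeight {μ : ℝ} (h1 : μ < 1) {n m : ℕ} (hm : n + 1 = m)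
    (p : n.Partition) (q : m.Partition) (hq : q.parts = 1 ::ₘ p.parts) :
    q.parts.count 1 * cutWeight μ q = μ * ((p.parts.card + 1) * cutWeight μ p) := by
  have hA : (q.parts.count 1 * q.parts.countPerms : ℝ) =
      (p.parts.card + 1) * p.parts.countPerms := by
    rw [hq]
    exact_mod_cast Multiset.count_mul_countPerms_cons _ _
  have hc : q.parts.card = p.parts.card + 1 := by simp [hq]
  have h2 : (1 - μ) ≠ 0 := by linarith
  unfold cutWeight
  subst hm
  rw [hc, pow_succ, pow_succ]
  have h3 : μ / (1 - μ) * (1 - μ) = μ := div_mul_cancel₀ _ h2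
  linear_combination ((μ / (1 - μ)) ^ p.parts.card * (1 - μ) ^ n * (μ / (1 - μ) * (1 - μ)) / μ) * hA
    + ((p.parts.card + 1) * p.parts.countPerms) * (μ / (1 - μ)) ^ p.parts.card * (1 - μ) ^ n / μ * h3

theorem filter_ne_zero_of_mem_partition {n : ℕ} (p : n.Partition) (a : ℕ) :
    (p.parts.erase a).filter (fun k => k ≠ 0) = p.parts.erase a :=
  Multiset.filter_eq_self.2 fun _ hx => (p.parts_pos (Multiset.mem_of_mem_erase hx)).ne'

/-- Detailed balance. Either `q` is `p` with a new row, or one row is lengthened, or both rules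
vanish. In the first two cases the rules count equal rows, and the marked-row identities for
`cutWeight` match the two sides. -/
theorem cutWeight_mul_rowRule {μ : ℝ} (h1 : μ < 1) {n m : ℕ} (hm : n + 1 = m)
    (p : n.Partition) (q : m.Partition) :
    cutWeight μ p * rowRule μ p q = cutWeight μ q * derowRule q p := by
  unfold rowRule derowRule
  by_cases hq : q.parts = 1 ::ₘ p.parts
  · have hz : p.parts.countP (fun κ => q.parts = (κ + 1) ::ₘ p.parts.erase κ) = 0 := by
      rw [Multiset.countP_eq_zero]
      intro κ hκ h
      have := congrArg Multiset.card (hq.symm.trans h)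
      rw [Multiset.card_cons, Multiset.card_cons, Multiset.card_erase_add_one hκ] at this
      omega
    have hD : q.parts.countP
        (fun κ => p.parts = ((κ - 1) ::ₘ q.parts.erase κ).filter (fun k => k ≠ 0)) =
        q.parts.count 1 := by
      apply Multiset.countP_eq_count_of_iff
      intro κ hκ
      constructor
      · intro h
        by_contra hne
        have hκ0 := q.parts_pos hκ
        rw [Multiset.filter_cons_of_pos _ (by omega), filter_ne_zero_of_mem_partition] at h
        have h' := congrArg Multiset.card h
        rw [Multiset.card_cons, Multiset.card_erase_add_one hκ, hq, Multiset.card_cons] at h'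
        omega
      · rintro rfl
        rw [Multiset.filter_cons_of_neg _ (by simp), filter_ne_zero_of_mem_partition, hq,
          Multiset.erase_cons_head]
    have hc : (q.parts.card : ℝ) = p.parts.card + 1 := by rw [hq]; simp
    rw [hz, hD, if_pos hq, hc, mul_comm (cutWeight μ q), div_mul_eq_mul_div,
      count_one_mul_cutWeight h1 hm p q hq]
    have : (p.parts.card + 1 : ℝ) ≠ 0 := by positivity
    field_simp
    simp
  rw [if_neg hq]
  by_cases hex : ∃ κ ∈ p.parts, q.parts = (κ + 1) ::ₘ p.parts.erase κ
  · obtain ⟨κ, hκ, hqκ⟩ := hex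
    obtain ⟨s, hs⟩ := Multiset.exists_cons_of_mem hκ
    rw [hs, Multiset.erase_cons_head] at hqκ
    have hκ0 := p.parts_pos hκ
    have hU : p.parts.countP (fun κ => q.parts = (κ + 1) ::ₘ p.parts.erase κ) =
        p.parts.count κ := by
      apply Multiset.countP_eq_count_of_iff
      intro x hx
      constructor
      · intro h
        by_contra hne
        -- If `x ≠ κ`, lengthening `x` would give `q` at least one more part `x + 1` than `s` has,
        -- whereas lengthening `κ` adds none.
        have h' := congrArg (Multiset.count (x + 1)) h
        have h'' := congrArg (Multiset.count (x + 1)) hs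
        rw [hqκ, Multiset.count_cons_of_ne (by omega), Multiset.count_cons_self,
          Multiset.count_erase_of_ne (by omega), hs] at h'
        have : Multiset.count (x + 1) s ≤ Multiset.count (x + 1) (κ ::ₘ s) :=
          Multiset.count_le_count_cons _ _ _
        omega
      · rintro rfl
        rw [hqκ, hs, Multiset.erase_cons_head]
    have hD : q.parts.countP
        (fun κ => p.parts = ((κ - 1) ::ₘ q.parts.erase κ).filter (fun k => k ≠ 0)) =
        q.parts.count (κ + 1) := by
      apply Multiset.countP_eq_count_of_iff
      intro x hx
      constructor
      · intro h
        by_contra hne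
        rw [Multiset.filter_cons, filter_ne_zero_of_mem_partition] at h
        have h' := congrArg (Multiset.count (κ + 1)) h
        rw [hs, Multiset.count_add, Multiset.count_cons_of_ne (by omega),
          Multiset.count_erase_of_ne (fun h => hne h.symm), hqκ, Multiset.count_cons_self] at h'
        omega
      · rintro rfl
        rw [Multiset.filter_cons_of_pos _ (by omega), filter_ne_zero_of_mem_partition, hqκ,
          Multiset.erase_cons_head, hs, Nat.add_sub_cancel]
    have hc : q.parts.card = p.parts.card := by simp [hs, hqκ]
    rw [hU, hD, hc, mul_comm (cutWeight μ q), div_mul_eq_mul_div,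
      count_mul_cutWeight_succ hm p q s κ hs hqκ]
    ring
  · have hU : p.parts.countP (fun κ => q.parts = (κ + 1) ::ₘ p.parts.erase κ) = 0 := by
      rw [Multiset.countP_eq_zero]
      intro κ hκ h
      exact hex ⟨κ, hκ, h⟩
    have hD : q.parts.countP
        (fun κ => p.parts = ((κ - 1) ::ₘ q.parts.erase κ).filter (fun k => k ≠ 0)) = 0 := by
      rw [Multiset.countP_eq_zero]
      intro κ hκ h
      obtain ⟨s, hs⟩ := Multiset.exists_cons_of_mem hκ
      have hκ0 := q.parts_pos hκ
      rw [Multiset.filter_cons, filter_ne_zero_of_mem_partition, hs, Multiset.erase_cons_head] at h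
      by_cases hκ1 : κ = 1
      · subst hκ1
        apply hq
        rw [hs, h]
        simp
      · rw [if_pos (by omega), Multiset.singleton_add] at h
        apply hex
        refine ⟨κ - 1, by simp [h], ?_⟩
        rw [hs, h, Multiset.erase_cons_head, Nat.sub_add_cancel hκ0]
    rw [hU, hD]
    simp

/-! ### Row sums of the two rules and transport of the cut weight. -/

theorem sum_countP_mul {m : ℕ} (u : Multiset ℕ) (g : ℕ → Multiset ℕ)
    (hg : ∀ κ ∈ u, ∃ q : m.Partition, q.parts = g κ) (f : Multiset ℕ → ℝ) :
    ∑ q : m.Partition, (u.countP fun κ => q.parts = g κ : ℝ) * f q.parts =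
      (u.map fun κ => f (g κ)).sum := by
  induction u using Multiset.induction_on with
  | empty => simp
  | cons a u ih =>
    obtain ⟨q₀, hq₀⟩ := hg a (Multiset.mem_cons_self _ _)
    have h : ∀ q : m.Partition, q.parts = g a ↔ q = q₀ := fun q => by
      rw [← hq₀, Nat.Partition.ext_iff]
    simp only [Multiset.countP_cons, Multiset.map_cons, Multiset.sum_cons, h]
    push_cast
    simp only [add_mul, Finset.sum_add_distrib,
      ih fun κ hκ => hg κ (Multiset.mem_cons_of_mem hκ)]
    simp [hq₀, add_comm]

theorem sum_rowRule_mul (μ : ℝ) {n m : ℕ} (hm : n + 1 = m) (p : n.Partition)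
    (f : Multiset ℕ → ℝ) :
    ∑ q : m.Partition, rowRule μ p q * f q.parts = μ * f (1 ::ₘ p.parts) +
      (1 - μ) * ((p.parts.map fun κ => f ((κ + 1) ::ₘ p.parts.erase κ)).sum / p.parts.card) := by
  have hnew : ∃ q : m.Partition, q.parts = 1 ::ₘ p.parts :=
    ⟨⟨1 ::ₘ p.parts, fun {i} hi => by
      rcases Multiset.mem_cons.1 hi with rfl | h
      exacts [one_pos, p.parts_pos h], by simp [p.parts_sum]; omega⟩, rfl⟩
  have hold : ∀ κ ∈ p.parts, ∃ q : m.Partition, q.parts = (κ + 1) ::ₘ p.parts.erase κ :=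
    fun κ hκ => ⟨⟨(κ + 1) ::ₘ p.parts.erase κ, fun {i} hi => by
      rcases Multiset.mem_cons.1 hi with rfl | h
      exacts [κ.succ_pos, p.parts_pos (Multiset.mem_of_mem_erase h)], by
        have h := p.parts_sum
        rw [← Multiset.cons_erase hκ, Multiset.sum_cons] at h
        rw [Multiset.sum_cons]
        omega⟩, rfl⟩
  rw [← sum_countP_mul p.parts _ hold f]
  obtain ⟨q₀, hq₀⟩ := hnew
  have h : ∀ q : m.Partition, q.parts = 1 ::ₘ p.parts ↔ q = q₀ := fun q => by
    rw [← hq₀, Nat.Partition.ext_iff]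
  simp only [rowRule, add_mul, Finset.sum_add_distrib, Finset.sum_div, Finset.mul_sum]
  congr 1
  · simp [h, hq₀]
  · exact Finset.sum_congr rfl fun q _ => by ring

theorem sum_rowRule (μ : ℝ) {n m : ℕ} (hn : 1 ≤ n) (hm : n + 1 = m) (p : n.Partition) :
    ∑ q : m.Partition, rowRule μ p q = 1 := by
  have h := sum_rowRule_mul μ hm p fun _ => 1
  have hc : (p.parts.card : ℝ) ≠ 0 := by exact_mod_cast (p.card_parts_pos hn).ne'
  simpa [hc] using h

theorem exists_partition_derow {n m : ℕ} (hm : n + 1 = m) (q : m.Partition) {κ : ℕ}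
    (hκ : κ ∈ q.parts) :
    ∃ p : n.Partition, p.parts = ((κ - 1) ::ₘ q.parts.erase κ).filter (fun k => k ≠ 0) := by
  refine ⟨Nat.Partition.ofSums n ((κ - 1) ::ₘ q.parts.erase κ) ?_, rfl⟩
  have h := q.parts_sum
  have hκ0 := q.parts_pos hκ
  rw [← Multiset.cons_erase hκ, Multiset.sum_cons] at h
  rw [Multiset.sum_cons]
  omega

theorem sum_derowRule {n m : ℕ} (hm : n + 1 = m) (q : m.Partition) :
    ∑ p : n.Partition, derowRule q p = 1 := by
  have h := sum_countP_mul q.parts _ (fun κ hκ => exists_partition_derow hm q hκ) fun _ => 1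
  have hc : (q.parts.card : ℝ) ≠ 0 := by exact_mod_cast (q.card_parts_pos (by omega)).ne'
  unfold derowRule
  simp only [mul_one, Multiset.map_const', Multiset.sum_replicate, nsmul_eq_mul] at h
  rw [← Finset.sum_div, h, div_self hc]

theorem rowRule_nonneg {μ : ℝ} (h0 : 0 ≤ μ) (h1 : μ ≤ 1) {n m : ℕ} (p : n.Partition)
    (q : m.Partition) : 0 ≤ rowRule μ p q := by
  have : 0 ≤ 1 - μ := by linarith
  unfold rowRule
  split_ifs <;> positivity

theorem derowRule_nonneg {n m : ℕ} (p : n.Partition) (q : m.Partition) : 0 ≤ derowRule p q := by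
  unfold derowRule
  positivity

theorem sum_cutWeight_mul_rowRule {μ : ℝ} (h1 : μ < 1) {n m : ℕ} (hm : n + 1 = m)
    (q : m.Partition) :
    ∑ p : n.Partition, cutWeight μ p * rowRule μ p q = cutWeight μ q := by
  simp only [cutWeight_mul_rowRule h1 hm, ← Finset.mul_sum, sum_derowRule hm, mul_one]

theorem sum_cutWeight_mul_derowRule {μ : ℝ} (h1 : μ < 1) {n m : ℕ} (hn : 1 ≤ n) (hm : n + 1 = m)
    (p : n.Partition) :
    ∑ q : m.Partition, cutWeight μ q * derowRule q p = cutWeight μ p := by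
  simp only [← cutWeight_mul_rowRule h1 hm, ← Finset.mul_sum, sum_rowRule μ hn hm, mul_one]

/-! ### Expectations under the cut weight. -/

/-- The expectation of `F` of the multiset of parts under the law `cutWeight μ` at level `n`. -/
noncomputable def cutMean (μ : ℝ) (n : ℕ) (F : Multiset ℕ → ℝ) : ℝ :=
  ∑ p : n.Partition, cutWeight μ p * F p.parts

theorem cutMean_succ {μ : ℝ} (h1 : μ < 1) (n : ℕ) (F : Multiset ℕ → ℝ) :
    cutMean μ (n + 1) F = cutMean μ n fun s => μ * F (1 ::ₘ s) +
      (1 - μ) * ((s.map fun κ => F ((κ + 1) ::ₘ s.erase κ)).sum / s.card) := by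
  unfold cutMean
  simp only [← sum_rowRule_mul μ rfl, Finset.mul_sum, ← mul_assoc]
  rw [Finset.sum_comm]
  exact Finset.sum_congr rfl fun q _ => by
    rw [← Finset.sum_mul, sum_cutWeight_mul_rowRule h1 rfl]

/-- At level `0` the total mass is `1 / μ`, not `1`. Since `0 / 0 = 0`, the up rule from the empty
partition only creates a row, with weight `μ`, so the recursion yields mass `1` from level `1` on.
-/
theorem cutMean_zero {μ : ℝ} (F : Multiset ℕ → ℝ) : cutMean μ 0 F = F 0 / μ := by
  simp [cutMean, cutWeight, div_eq_inv_mul]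

theorem cutMean_congr {μ : ℝ} {n : ℕ} {F G : Multiset ℕ → ℝ}
    (h : ∀ p : n.Partition, F p.parts = G p.parts) : cutMean μ n F = cutMean μ n G :=
  Finset.sum_congr rfl fun p _ => by rw [h p]

theorem cutMean_one {μ : ℝ} (h0 : 0 < μ) (h1 : μ < 1) {n : ℕ} (hn : 1 ≤ n) :
    cutMean μ n (fun _ => 1) = 1 := by
  induction n, hn using Nat.le_induction with
  | base => rw [cutMean_succ h1, cutMean_zero]; simp [h0.ne']
  | succ n hn ih =>
    rw [cutMean_succ h1]
    refine (cutMean_congr fun p => ?_).trans ih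
    have hc : (p.parts.card : ℝ) ≠ 0 := by exact_mod_cast (p.card_parts_pos hn).ne'
    simp [hc]

theorem sum_cutWeight {μ : ℝ} (h0 : 0 < μ) (h1 : μ < 1) {n : ℕ} (hn : 1 ≤ n) :
    ∑ p : n.Partition, cutWeight μ p = 1 := by
  simpa [cutMean] using cutMean_one h0 h1 hn

/-! ### Existence and uniqueness of the stationary law on one level. -/

theorem derowRow_apply (μ : ℝ) (n : ℕ) (p q : n.Partition) :
    derowRow μ n p q = ∑ z : (n - 1).Partition, derowRule p z * rowRule μ z q := rfl

theorem derowRow_nonneg {μ : ℝ} (h0 : 0 ≤ μ) (h1 : μ ≤ 1) {n : ℕ} (p q : n.Partition) :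
    0 ≤ derowRow μ n p q := by
  rw [derowRow_apply]
  exact Finset.sum_nonneg fun _ _ => mul_nonneg (derowRule_nonneg _ _) (rowRule_nonneg h0 h1 _ _)

theorem sum_derowRow (μ : ℝ) {n : ℕ} (hn : 2 ≤ n) (p : n.Partition) :
    ∑ q, derowRow μ n p q = 1 := by
  simp only [derowRow_apply]
  rw [Finset.sum_comm]
  simp only [← Finset.mul_sum, sum_rowRule μ (show 1 ≤ n - 1 by omega) (show n - 1 + 1 = n by omega),
    mul_one, sum_derowRule (show n - 1 + 1 = n by omega)]

theorem cutWeight_mul_derowRow {μ : ℝ} (h1 : μ < 1) {n : ℕ} (hn : 1 ≤ n) (p q : n.Partition) :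
    cutWeight μ p * derowRow μ n p q = cutWeight μ q * derowRow μ n q p := by
  simp only [derowRow_apply, Finset.mul_sum, ← mul_assoc,
    ← cutWeight_mul_rowRule h1 (show n - 1 + 1 = n by omega)]
  exact Finset.sum_congr rfl fun z _ => by ring

theorem isStationaryDistribution_cutWeight {μ : ℝ} (h0 : 0 < μ) (h1 : μ < 1) {n : ℕ}
    (hn : 2 ≤ n) : IsStationaryDistribution (derowRow μ n) (cutWeight μ) := by
  refine ⟨⟨fun p => (cutWeight_pos h0 h1 p).le, sum_cutWeight h0 h1 (by omega)⟩, ?_⟩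
  ext q
  simp only [Matrix.vecMul, dotProduct, cutWeight_mul_derowRow h1 (show 1 ≤ n by omega) _ q,
    ← Finset.mul_sum, sum_derowRow μ hn, mul_one]

/-- From every partition with a part `≥ 2` a square can be moved into a new row. -/
theorem exists_derowRow_pos {μ : ℝ} (h0 : 0 < μ) (h1 : μ < 1) {n : ℕ} (p : n.Partition) {κ : ℕ}
    (hκ : κ ∈ p.parts) (h2 : 2 ≤ κ) :
    ∃ q : n.Partition, 0 < derowRow μ n p q ∧ q.parts.card = p.parts.card + 1 := by
  have hn : 2 ≤ n := h2.trans (Nat.Partition.le_of_mem_parts hκ)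
  obtain ⟨z, hz⟩ := exists_partition_derow (show n - 1 + 1 = n by omega) p hκ
  have hz' : z.parts = (κ - 1) ::ₘ p.parts.erase κ := by
    rw [hz, Multiset.filter_cons_of_pos _ (by omega), filter_ne_zero_of_mem_partition]
  have hD : 0 < derowRule p z := by
    unfold derowRule
    have hc : (0 : ℝ) < p.parts.card := by exact_mod_cast p.card_parts_pos (by omega)
    have : 0 < p.parts.countP
        (fun κ => z.parts = ((κ - 1) ::ₘ p.parts.erase κ).filter (fun k => k ≠ 0)) :=
      Multiset.countP_pos.2 ⟨κ, hκ, hz⟩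
    have : (0 : ℝ) < p.parts.countP
        (fun κ => z.parts = ((κ - 1) ::ₘ p.parts.erase κ).filter (fun k => k ≠ 0)) := by
      exact_mod_cast this
    positivity
  let q : n.Partition := ⟨1 ::ₘ z.parts, fun {i} hi => by
      rcases Multiset.mem_cons.1 hi with rfl | h
      exacts [one_pos, z.parts_pos h], by simp [z.parts_sum]; omega⟩
  have hU : 0 < rowRule μ z q := by
    have : 0 ≤ 1 - μ := by linarith
    unfold rowRule
    rw [if_pos rfl]
    positivity
  refine ⟨q, ?_, ?_⟩
  · rw [derowRow_apply]
    exact (mul_pos hD hU).trans_le (Finset.single_le_sum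
      (f := fun z => derowRule p z * rowRule μ z q)
      (fun z _ => mul_nonneg (derowRule_nonneg _ _) (rowRule_nonneg h0.le h1.le _ _))
      (Finset.mem_univ z))
  · change (1 ::ₘ z.parts).card = _
    rw [Multiset.card_cons, hz', Multiset.card_cons, Multiset.card_erase_add_one hκ]

theorem parts_eq_replicate_of_le_one {n : ℕ} (p : n.Partition) (h : ∀ κ ∈ p.parts, κ < 2) :
    p.parts = Multiset.replicate n 1 := by
  have h' : p.parts = Multiset.replicate p.parts.card 1 :=
    Multiset.eq_replicate_card.2 fun κ hκ => by
      have := h κ hκ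
      have := p.parts_pos hκ
      omega
  have hs := p.parts_sum
  rw [h', Multiset.sum_replicate] at hs
  rw [h']
  congr 1
  simpa using hs

/-- A harmonic function of the chain takes its maximum at the partition into parts `1`. -/
theorem exists_max_of_harmonic {μ : ℝ} (h0 : 0 < μ) (h1 : μ < 1) {n : ℕ} (hn : 2 ≤ n)
    (f : n.Partition → ℝ) (hf : ∀ p, ∑ q, derowRow μ n p q * f q = f p) :
    ∃ p : n.Partition, p.parts = Multiset.replicate n 1 ∧ ∀ q, f q ≤ f p := by
  obtain ⟨p₀, -, hp₀⟩ := Finset.exists_max_image Finset.univ f Finset.univ_nonempty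
  -- Among the maximizers take one with the most parts. States reached from a maximizer with
  -- positive probability are maximizers too, so a part `≥ 2` would lead to a maximizer with one
  -- more part.
  obtain ⟨p, hp, hmax⟩ := Finset.exists_max_image
    (Finset.univ.filter fun p => f p = f p₀) (fun p => p.parts.card) ⟨p₀, by simp⟩
  replace hp : f p = f p₀ := by simpa using hp
  refine ⟨p, parts_eq_replicate_of_le_one p fun κ hκ => ?_, fun q => hp ▸ hp₀ q (Finset.mem_univ q)⟩
  by_contra! h2
  obtain ⟨q, hq, hcard⟩ := exists_derowRow_pos h0 h1 p hκ h2
  have hsum : ∑ q, derowRow μ n p q * (f p - f q) = 0 := by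
    simp only [mul_sub, Finset.sum_sub_distrib, ← Finset.sum_mul, sum_derowRow μ hn, hf]
    ring
  have hz := (Finset.sum_eq_zero_iff_of_nonneg fun q _ => mul_nonneg
    (derowRow_nonneg h0.le h1.le p q) (sub_nonneg.2 (hp ▸ hp₀ q (Finset.mem_univ q)))).1 hsum q
    (Finset.mem_univ q)
  have hfq : f q = f p₀ := by
    rcases mul_eq_zero.1 hz with h | h
    · exact absurd h hq.ne'
    · linarith
  have := hmax q (by simpa using hfq)
  omega

/-- By reversibility the density of `ν` with respect to `cutWeight μ` is harmonic. Both it and its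
negative are maximal at the partition into ones, so it is constant, and the total mass fixes the
constant. -/
theorem eq_cutWeight_of_isStationaryDistribution {μ : ℝ} (h0 : 0 < μ) (h1 : μ < 1) {n : ℕ}
    (hn : 2 ≤ n) {ν : n.Partition → ℝ} (hν : IsStationaryDistribution (derowRow μ n) ν) :
    ν = cutWeight μ := by
  have hpos := fun p : n.Partition => cutWeight_pos h0 h1 p
  have hf : ∀ p, ∑ q, derowRow μ n p q * (ν q / cutWeight μ q) = ν p / cutWeight μ p := by
    intro p
    rw [eq_div_iff (hpos p).ne', Finset.sum_mul]
    refine Eq.trans (Finset.sum_congr rfl fun q _ => ?_) (congrFun hν.2 p)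
    have h := cutWeight_mul_derowRow h1 (show 1 ≤ n by omega) p q
    have hq := (hpos q).ne'
    field_simp
    linear_combination ν q * h
  obtain ⟨p, hp, hle⟩ := exists_max_of_harmonic h0 h1 hn _ hf
  obtain ⟨p', hp', hge⟩ := exists_max_of_harmonic h0 h1 hn (fun q => -(ν q / cutWeight μ q))
    fun p => by simp only [mul_neg, Finset.sum_neg_distrib, hf]
  obtain rfl : p' = p := Nat.Partition.ext (hp'.trans hp.symm)
  have hconst : ∀ q, ν q = ν p' / cutWeight μ p' * cutWeight μ q := fun q => by
    rw [← le_antisymm (hle q) (neg_le_neg_iff.1 (hge q)), div_mul_cancel₀ _ (hpos q).ne']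
  have hs := hν.1.2
  rw [Finset.sum_congr rfl fun q _ => hconst q, ← Finset.mul_sum,
    sum_cutWeight h0 h1 (show 1 ≤ n by omega), mul_one] at hs
  ext q
  rw [hconst q, hs, one_mul]

/-! ### The toggling chain. -/

/-- The stationary distribution of the toggling chain: half of the law `cutWeight μ` on each level. -/
noncomputable def toggleWeight (μ : ℝ) (n : ℕ) : (n - 1).Partition ⊕ n.Partition → ℝ :=
  Sum.elim (fun p => cutWeight μ p / 2) (fun p => cutWeight μ p / 2)

theorem isStationaryDistribution_toggleWeight {μ : ℝ} (h0 : 0 < μ) (h1 : μ < 1) {n : ℕ}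
    (hn : 2 ≤ n) : IsStationaryDistribution (derowRowToggle μ n) (toggleWeight μ n) := by
  refine ⟨⟨?_, ?_⟩, ?_⟩
  · rintro (p | p)
    exacts [(half_pos (cutWeight_pos h0 h1 p)).le, (half_pos (cutWeight_pos h0 h1 p)).le]
  · simp only [Fintype.sum_sum_type, toggleWeight, Sum.elim_inl, Sum.elim_inr, ← Finset.sum_div,
      sum_cutWeight h0 h1 (show 1 ≤ n by omega), sum_cutWeight h0 h1 (show 1 ≤ n - 1 by omega)]
    norm_num
  · ext (p | p)
    · simp only [Matrix.vecMul, dotProduct, Fintype.sum_sum_type, toggleWeight, Sum.elim_inl,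
        Sum.elim_inr, derowRowToggle, upDownMatrix, Matrix.fromBlocks_apply₁₁,
        Matrix.fromBlocks_apply₂₁, Matrix.zero_apply, mul_zero, Finset.sum_const_zero, zero_add,
        Matrix.of_apply, div_mul_eq_mul_div, ← Finset.sum_div]
      rw [sum_cutWeight_mul_derowRule h1 (by omega) (by omega)]
    · simp only [Matrix.vecMul, dotProduct, Fintype.sum_sum_type, toggleWeight, Sum.elim_inl,
        Sum.elim_inr, derowRowToggle, upDownMatrix, Matrix.fromBlocks_apply₁₂,
        Matrix.fromBlocks_apply₂₂, Matrix.zero_apply, mul_zero, Finset.sum_const_zero, add_zero,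
        Matrix.of_apply, div_mul_eq_mul_div, ← Finset.sum_div]
      rw [sum_cutWeight_mul_rowRule h1 (by omega)]

/-- Stationarity forces mass `1 / 2` on each level. Twice the upper half is then stationary for the
observed chain, hence known, and the down rule determines the lower half from it. -/
theorem eq_toggleWeight_of_isStationaryDistribution {μ : ℝ} (h0 : 0 < μ) (h1 : μ < 1) {n : ℕ}
    (hn : 2 ≤ n) {ρ : (n - 1).Partition ⊕ n.Partition → ℝ}
    (hρ : IsStationaryDistribution (derowRowToggle μ n) ρ) : ρ = toggleWeight μ n := by
  have hm : n - 1 + 1 = n := by omega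
  have hA : ∀ p, ∑ q, ρ (Sum.inr q) * derowRule q p = ρ (Sum.inl p) := fun p => by
    simpa [Matrix.vecMul, dotProduct, derowRowToggle, upDownMatrix] using
      congrFun hρ.2 (Sum.inl p)
  have hB : ∀ q, ∑ p, ρ (Sum.inl p) * rowRule μ p q = ρ (Sum.inr q) := fun q => by
    simpa [Matrix.vecMul, dotProduct, derowRowToggle, upDownMatrix] using
      congrFun hρ.2 (Sum.inr q)
  have hmass : ∑ p, ρ (Sum.inl p) = ∑ q, ρ (Sum.inr q) := by
    simp only [← hA]
    rw [Finset.sum_comm]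
    simp only [← Finset.mul_sum, sum_derowRule hm, mul_one]
  have htot := hρ.1.2
  rw [Fintype.sum_sum_type, hmass] at htot
  have hst : IsStationaryDistribution (derowRow μ n) fun q => 2 * ρ (Sum.inr q) := by
    refine ⟨⟨fun q => mul_nonneg two_pos.le (hρ.1.1 _), ?_⟩, ?_⟩
    · rw [← Finset.mul_sum]
      linarith
    · ext q
      simp only [Matrix.vecMul, dotProduct, derowRow_apply, Finset.mul_sum]
      rw [Finset.sum_comm, ← hB q, Finset.mul_sum]
      refine Finset.sum_congr rfl fun z _ => ?_
      rw [← hA z, Finset.sum_mul, Finset.mul_sum]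
      exact Finset.sum_congr rfl fun p _ => by ring
  have hinr : ∀ q, ρ (Sum.inr q) = cutWeight μ q / 2 := fun q => by
    have := congrFun (eq_cutWeight_of_isStationaryDistribution h0 h1 hn hst) q
    linarith
  ext (p | q)
  · rw [← hA p]
    simp only [hinr, div_mul_eq_mul_div, ← Finset.sum_div]
    rw [sum_cutWeight_mul_derowRule h1 (by omega) hm]
    rfl
  · exact hinr q

/-! ### Moments of the number of long rows. -/

/-- A partition with a marked row is a pair of `κ` and the remaining rows. Lengthening the marked
row is a bijection onto the marked partitions of the next level whose marked row is not `1`, and it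
multiplies weights by `1 - μ`; `hF` removes the marked rows `1`. -/
theorem cutMean_sum_map_erase_succ {μ : ℝ} (n : ℕ) (F : ℕ → Multiset ℕ → ℝ)
    (hF : ∀ s, F 1 s = 0) :
    cutMean μ (n + 1) (fun s => (s.map fun κ => F κ (s.erase κ)).sum) =
      (1 - μ) * cutMean μ n fun s => (s.map fun κ => F (κ + 1) (s.erase κ)).sum := by
  unfold cutMean
  simp only [Finset.sum_multiset_map_count, Finset.mul_sum, nsmul_eq_mul]
  rw [Finset.sum_sigma', Finset.sum_sigma']
  have key : ∀ (p : n.Partition) (q : (n + 1).Partition) (s : Multiset ℕ) (κ : ℕ),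
      p.parts = κ ::ₘ s → q.parts = (κ + 1) ::ₘ s →
      cutWeight μ q * (q.parts.count (κ + 1) * F (κ + 1) (q.parts.erase (κ + 1))) =
        (1 - μ) * (cutWeight μ p * (p.parts.count κ * F (κ + 1) (p.parts.erase κ))) := by
    intro p q s κ hp hq
    have h1 : q.parts.erase (κ + 1) = s := by rw [hq, Multiset.erase_cons_head]
    have h2 : p.parts.erase κ = s := by rw [hp, Multiset.erase_cons_head]
    rw [h1, h2]
    linear_combination F (κ + 1) s * count_mul_cutWeight_succ (μ := μ) rfl p q s κ hp hq
  symm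
  have up : ∀ (p : n.Partition) (κ : ℕ), κ ∈ p.parts →
      ∃ q : (n + 1).Partition, q.parts = (κ + 1) ::ₘ p.parts.erase κ := fun p κ hκ =>
    ⟨⟨(κ + 1) ::ₘ p.parts.erase κ, fun {i} hi => by
      rcases Multiset.mem_cons.1 hi with rfl | h
      exacts [κ.succ_pos, p.parts_pos (Multiset.mem_of_mem_erase h)], by
        have h := p.parts_sum
        rw [← Multiset.cons_erase hκ, Multiset.sum_cons] at h
        rw [Multiset.sum_cons]
        omega⟩, rfl⟩
  choose! e he using up
  refine Finset.sum_bij_ne_zero (fun x _ _ => ⟨e x.1 x.2, x.2 + 1⟩) ?_ ?_ ?_ ?_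
  · rintro ⟨p, κ⟩ hx -
    have hκ : κ ∈ p.parts := by simpa using hx
    simp [he p κ hκ]
  · rintro ⟨p, κ⟩ hx - ⟨p', κ'⟩ hx' - h
    have hκ : κ ∈ p.parts := by simpa using hx
    have hκ' : κ' ∈ p'.parts := by simpa using hx'
    simp only [Sigma.mk.injEq, heq_eq_eq, Nat.add_right_cancel_iff] at h ⊢
    obtain ⟨h, rfl⟩ := h
    refine ⟨?_, rfl⟩
    have h' := congrArg Nat.Partition.parts h
    rw [he p κ hκ, he p' κ hκ', Multiset.cons_inj_right] at h'
    rw [Nat.Partition.ext_iff, ← Multiset.cons_erase hκ, ← Multiset.cons_erase hκ', h']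
  · rintro ⟨q, κ⟩ hx hne
    have hκ : κ ∈ q.parts := by simpa using hx
    have hκ0 := q.parts_pos hκ
    have hκ1 : κ ≠ 1 := by
      rintro rfl
      simp [hF] at hne
    obtain ⟨k, rfl⟩ : ∃ k, κ = k + 1 := ⟨κ - 1, by omega⟩
    have hk : 0 < k := by omega
    obtain ⟨p, hp⟩ := exists_partition_derow rfl q hκ
    rw [Nat.add_sub_cancel, Multiset.filter_cons_of_pos (p := fun k => k ≠ 0) _ hk.ne',
      filter_ne_zero_of_mem_partition] at hp
    have hkp : k ∈ p.parts := by simp [hp]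
    have hee : e p k = q := by
      rw [Nat.Partition.ext_iff, he p k hkp, hp, Multiset.erase_cons_head, Multiset.cons_erase hκ]
    refine ⟨⟨p, k⟩, by simpa using hkp, ?_, by simp [hee]⟩
    have := key p q _ k hp (Multiset.cons_erase hκ).symm
    rwa [← this]
  · rintro ⟨p, κ⟩ hx -
    have hκ : κ ∈ p.parts := by simpa using hx
    exact (key p _ _ κ (Multiset.cons_erase hκ).symm (he p κ hκ)).symm

/-- The number of ordered pairs of different rows, the first of length `≥ t` and the second of
length `≥ u`. -/
noncomputable def pairCount (t u : ℕ) (s : Multiset ℕ) : ℝ :=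
  s.countP (t ≤ ·) * s.countP (u ≤ ·) - s.countP (max t u ≤ ·)

theorem pairCount_comm (t u : ℕ) (s : Multiset ℕ) : pairCount t u s = pairCount u t s := by
  unfold pairCount
  rw [mul_comm, max_comm]

theorem countP_erase_real {s : Multiset ℕ} {κ : ℕ} (hκ : κ ∈ s) (u : ℕ) :
    ((s.erase κ).countP (u ≤ ·) : ℝ) = s.countP (u ≤ ·) - if u ≤ κ then 1 else 0 := by
  obtain ⟨r, rfl⟩ := Multiset.exists_cons_of_mem hκ
  rw [Multiset.erase_cons_head, Multiset.countP_cons]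
  split_ifs <;> simp

/-- This puts ordered pairs into marked-row form, so that either row of the pair can be shortened
alone. -/
theorem pairCount_eq_sum (t u : ℕ) (s : Multiset ℕ) :
    pairCount t u s =
      (s.map fun κ => (if t ≤ κ then (1 : ℝ) else 0) * (s.erase κ).countP (u ≤ ·)).sum := by
  have h : (s.map fun κ => (if t ≤ κ then (1 : ℝ) else 0) * (s.erase κ).countP (u ≤ ·)) =
      s.map fun κ => (if t ≤ κ then (1 : ℝ) else 0) * s.countP (u ≤ ·) -
        if max t u ≤ κ then (1 : ℝ) else 0 := by
    refine Multiset.map_congr rfl fun κ hκ => ?_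
    rw [countP_erase_real hκ]
    by_cases h1 : t ≤ κ <;> by_cases h2 : u ≤ κ <;> simp [h1, h2]
  rw [h, Multiset.sum_map_sub, Multiset.sum_map_mul_right, ← Multiset.natCast_countP,
    ← Multiset.natCast_countP]
  rfl

theorem cutMean_countP_succ {μ : ℝ} (n : ℕ) {t : ℕ} (ht : 1 ≤ t) :
    cutMean μ (n + 1) (fun s => s.countP (t + 1 ≤ ·)) =
      (1 - μ) * cutMean μ n fun s => s.countP (t ≤ ·) := by
  have h := cutMean_sum_map_erase_succ (μ := μ) n (fun κ _ => if t + 1 ≤ κ then 1 else 0)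
    fun s => if_neg (by omega)
  simpa only [Nat.add_le_add_iff_right, ← Multiset.natCast_countP] using h

theorem cutMean_pairCount_succ {μ : ℝ} (n : ℕ) {t : ℕ} (ht : 1 ≤ t) (u : ℕ) :
    cutMean μ (n + 1) (pairCount (t + 1) u) = (1 - μ) * cutMean μ n (pairCount t u) := by
  have h := cutMean_sum_map_erase_succ (μ := μ) n
    (fun κ s => (if t + 1 ≤ κ then (1 : ℝ) else 0) * s.countP (u ≤ ·))
    fun s => by rw [if_neg (by omega), zero_mul]
  simpa only [Nat.add_le_add_iff_right, ← pairCount_eq_sum] using h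

theorem countP_one_le {n : ℕ} (p : n.Partition) : p.parts.countP (1 ≤ ·) = p.parts.card :=
  Multiset.countP_eq_card.2 fun _ hκ => p.parts_pos hκ

theorem cutMean_linear {μ : ℝ} (n : ℕ) (a b : ℝ) (F G : Multiset ℕ → ℝ) :
    cutMean μ n (fun s => a * F s + b * G s) = a * cutMean μ n F + b * cutMean μ n G := by
  simp only [cutMean, mul_add, Finset.sum_add_distrib, Finset.mul_sum]
  congr 1 <;> exact Finset.sum_congr rfl fun _ _ => by ring

theorem cutMean_succ_card {μ : ℝ} (h1 : μ < 1) {n : ℕ} (hn : 1 ≤ n) (g : ℕ → ℝ) :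
    cutMean μ (n + 1) (fun s => g s.card) =
      cutMean μ n fun s => μ * g (s.card + 1) + (1 - μ) * g s.card := by
  rw [cutMean_succ h1]
  refine cutMean_congr fun p => ?_
  have hc : (p.parts.card : ℝ) ≠ 0 := by exact_mod_cast (p.card_parts_pos hn).ne'
  have h : (p.parts.map fun κ => g ((κ + 1) ::ₘ p.parts.erase κ).card) =
      p.parts.map fun _ => g p.parts.card := Multiset.map_congr rfl fun κ hκ => by
    rw [Multiset.card_cons, Multiset.card_erase_add_one hκ]
  rw [h]
  simp [hc]

/-- The number of parts at level `n + 1` is one plus a binomial number of cuts among `n` places. -/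
theorem cutMean_card {μ : ℝ} (h0 : 0 < μ) (h1 : μ < 1) (n : ℕ) :
    cutMean μ (n + 1) (fun s => s.card) = 1 + n * μ := by
  induction n with
  | zero => rw [cutMean_succ h1, cutMean_zero]; simp [h0.ne']
  | succ n ih =>
    rw [cutMean_succ_card h1 n.succ_pos fun k => (k : ℝ)]
    have h : ∀ s : Multiset ℕ, μ * ((s.card + 1 : ℕ) : ℝ) + (1 - μ) * s.card =
        1 * s.card + μ * 1 := fun s => by push_cast; ring
    simp only [h]
    rw [cutMean_linear, ih, cutMean_one h0 h1 n.succ_pos]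
    push_cast
    ring

theorem cutMean_card_mul_pred {μ : ℝ} (h0 : 0 < μ) (h1 : μ < 1) (n : ℕ) :
    cutMean μ (n + 1) (fun s => s.card * (s.card - 1)) =
      2 * (n * μ) + n * (n - 1) * μ ^ 2 := by
  induction n with
  | zero => rw [cutMean_succ h1, cutMean_zero]; simp
  | succ n ih =>
    rw [cutMean_succ_card h1 n.succ_pos fun k => (k : ℝ) * (k - 1)]
    have h : ∀ s : Multiset ℕ, μ * (((s.card + 1 : ℕ) : ℝ) * ((s.card + 1 : ℕ) - 1)) +
        (1 - μ) * (s.card * (s.card - 1)) =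
        1 * (s.card * (s.card - 1)) + (2 * μ) * s.card := fun s => by push_cast; ring
    simp only [h]
    rw [cutMean_linear, ih, cutMean_card h0 h1]
    push_cast
    ring

theorem cutMean_countP {μ : ℝ} (h0 : 0 < μ) (h1 : μ < 1) (n u : ℕ) :
    cutMean μ (n + u + 1) (fun s => s.countP (u + 1 ≤ ·)) = (1 - μ) ^ u * (1 + n * μ) := by
  induction u with
  | zero =>
    rw [pow_zero, one_mul, ← cutMean_card h0 h1]
    exact cutMean_congr fun p => by rw [countP_one_le]
  | succ u ih => rw [cutMean_countP_succ _ (by omega), ← add_assoc, ih, pow_succ]; ring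

theorem cutMean_pairCount_one_le {μ : ℝ} (h0 : 0 < μ) (h1 : μ < 1) (n : ℕ) :
    cutMean μ n (pairCount 1 1) ≤ (1 + n * μ) ^ 2 := by
  cases n with
  | zero =>
    rw [cutMean_zero]
    simp [pairCount]
  | succ n =>
    have h : cutMean μ (n + 1) (pairCount 1 1) = 2 * (n * μ) + n * (n - 1) * μ ^ 2 := by
      rw [← cutMean_card_mul_pred h0 h1]
      refine cutMean_congr fun p => ?_
      rw [pairCount, max_self, countP_one_le]
      ring
    rw [h]
    push_cast
    nlinarith [mul_nonneg n.cast_nonneg (sq_nonneg μ), sq_nonneg μ]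

/-- Shortening the two rows of a pair to threshold `1` takes `t + u` steps, each giving a factor `1
- μ` and lowering the level. The fixed bound `M` absorbs the change of level; at level `0` there are
no pairs. -/
theorem cutMean_pairCount_le {μ : ℝ} (h0 : 0 < μ) (h1 : μ < 1) {M : ℕ} (t u n : ℕ) (hn : n ≤ M) :
    cutMean μ n (pairCount (t + 1) (u + 1)) ≤ (1 - μ) ^ (t + u) * (1 + M * μ) ^ 2 := by
  have hμ : 0 < 1 - μ := by linarith
  induction t generalizing n u with
  | zero =>
    induction u generalizing n with
    | zero =>
      refine (cutMean_pairCount_one_le h0 h1 n).trans ?_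
      have : (n : ℝ) ≤ M := by exact_mod_cast hn
      simp only [add_zero, pow_zero, one_mul]
      gcongr
    | succ u ih =>
      cases n with
      | zero => rw [cutMean_zero]; simp only [pairCount]; simp; positivity
      | succ n =>
        have hc : pairCount (0 + 1) (u + 1 + 1) = pairCount (u + 1 + 1) (0 + 1) :=
          funext fun s => pairCount_comm _ _ s
        have hc' : pairCount (u + 1) (0 + 1) = pairCount (0 + 1) (u + 1) :=
          funext fun s => pairCount_comm _ _ s
        rw [hc, cutMean_pairCount_succ _ (by omega), hc']
        have := mul_le_mul_of_nonneg_left (ih n (by omega)) hμ.le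
        refine this.trans_eq ?_
        ring
  | succ t ih =>
    cases n with
    | zero => rw [cutMean_zero]; simp only [pairCount]; simp; positivity
    | succ n =>
      rw [cutMean_pairCount_succ _ (by omega)]
      refine (mul_le_mul_of_nonneg_left (ih u n (by omega)) hμ.le).trans_eq ?_
      ring

theorem cutMean_countP_sq_le {μ : ℝ} (h0 : 0 < μ) (h1 : μ < 1) (n u : ℕ) :
    cutMean μ n (fun s => (s.countP (u + 1 ≤ ·) : ℝ) ^ 2) ≤
      (1 - μ) ^ u * (1 - μ) ^ u * (1 + n * μ) ^ 2 +
        cutMean μ n fun s => s.countP (u + 1 ≤ ·) := by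
  have h : (fun s : Multiset ℕ => (s.countP (u + 1 ≤ ·) : ℝ) ^ 2) =
      fun s => 1 * pairCount (u + 1) (u + 1) s + 1 * (s.countP (u + 1 ≤ ·) : ℝ) := by
    funext s
    rw [pairCount, max_self]
    ring
  rw [h, cutMean_linear, one_mul, one_mul, ← pow_add]
  gcongr
  exact cutMean_pairCount_le h0 h1 u u n le_rfl

/-! ### Reduction to a grid, and limits of the scaled quantities. -/

theorem exp_neg_sub_exp_neg_le {a b : ℝ} (ha : 0 ≤ a) (hab : a ≤ b) :
    Real.exp (-a) - Real.exp (-b) ≤ b - a := by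
  have h1 : Real.exp (-a) ≤ 1 := Real.exp_le_one_iff.2 (by linarith)
  have h2 := Real.add_one_le_exp (-(b - a))
  have h3 : Real.exp (-b) = Real.exp (-a) * Real.exp (-(b - a)) := by
    rw [← Real.exp_add]
    congr 1
    ring
  have h4 := Real.exp_pos (-a)
  rw [h3]
  nlinarith

/-- A decreasing nonnegative function that is close to `exp (-x)` on a fine grid is close to it
everywhere. -/
theorem abs_sub_exp_neg_lt_of_grid {f : ℝ → ℝ} {ε : ℝ} (hε : 0 < ε) (h0 : ∀ x, 0 ≤ f x)
    (hf : Antitone f) {K : ℕ} (hK : Real.exp (-(K * (ε / 3))) < ε / 3)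
    (hgrid : ∀ i ∈ Finset.range (K + 1),
      |f (i * (ε / 3)) - Real.exp (-(i * (ε / 3)))| < ε / 3)
    {x : ℝ} (hx : 0 ≤ x) : |f x - Real.exp (-x)| < ε := by
  -- Beyond `K * h` both functions are small. Before it, `x` lies between two adjacent grid points;
  -- monotonicity, the error `h` at the grid and the 1-Lipschitz bound for `exp (-x)` cost at most
  -- `2 * h`.
  set h := ε / 3 with hh
  have hpos : 0 < h := by positivity
  have hε3 : ε = h + h + h := by rw [hh]; ring
  rw [abs_sub_lt_iff]
  have hxpos := Real.exp_pos (-x)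
  by_cases hxK : K * h ≤ x
  · have h1 := hf hxK
    have h2 := (abs_sub_lt_iff.1 (hgrid K (by simp))).1
    have h3 : Real.exp (-x) ≤ Real.exp (-(K * h)) := Real.exp_le_exp.2 (by linarith)
    have := h0 x
    constructor <;> linarith
  · push Not at hxK
    have hle : (⌊x / h⌋₊ : ℝ) * h ≤ x := (le_div_iff₀ hpos).1 (Nat.floor_le (by positivity))
    have hlt : x < ((⌊x / h⌋₊ + 1 : ℕ) : ℝ) * h :=
      (div_lt_iff₀ hpos).1 (by push_cast; exact Nat.lt_floor_add_one _)
    have hi : ⌊x / h⌋₊ < K := by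
      rw [Nat.floor_lt (by positivity), div_lt_iff₀ hpos]
      exact hxK
    have h1 := (abs_sub_lt_iff.1 (hgrid ⌊x / h⌋₊ (by simp; omega))).1
    have h2 := (abs_sub_lt_iff.1 (hgrid (⌊x / h⌋₊ + 1) (by simp; omega))).2
    have h3 := hf hle
    have h4 := hf hlt.le
    have h5 := exp_neg_sub_exp_neg_le (by positivity) hle
    have h6 := exp_neg_sub_exp_neg_le hx hlt.le
    push_cast at h2 h4 h6 hlt
    constructor <;> linarith

/-- In the definition the parts are first mapped to a multiset of reals; this returns to counting
natural parts. -/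
theorem scaledBoundary_eq (a : ℝ) {m : ℕ} (p : m.Partition) (x : ℝ) :
    scaledBoundary a p x = a / m * p.parts.countP (fun k : ℕ => a * x ≤ (k : ℝ)) := by
  have h : (p.parts >>= fun k : ℕ => pure (k : ℝ)) = p.parts.map fun k : ℕ => (k : ℝ) :=
    Multiset.bind_singleton _ _
  unfold scaledBoundary
  rw [h, Multiset.countP_map, Multiset.countP_eq_card_filter]

theorem scaledBoundary_nonneg {a : ℝ} (ha : 0 ≤ a) {m : ℕ} (p : m.Partition) (x : ℝ) :
    0 ≤ scaledBoundary a p x := by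
  unfold scaledBoundary
  positivity

theorem scaledBoundary_antitone {a : ℝ} (ha : 0 ≤ a) {m : ℕ} (p : m.Partition) :
    Antitone (scaledBoundary a p) := by
  intro x y hxy
  rw [scaledBoundary_eq, scaledBoundary_eq]
  refine mul_le_mul_of_nonneg_left ?_ (by positivity)
  rw [Nat.cast_le, Multiset.countP_eq_card_filter, Multiset.countP_eq_card_filter]
  exact Multiset.card_le_card (Multiset.monotone_filter_right (p := fun k : ℕ => a * y ≤ k)
    (q := fun k : ℕ => a * x ≤ k) _ fun k hk => (mul_le_mul_of_nonneg_left hxy ha).trans hk)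

/-- The truncated `- 1 + 1` replaces the threshold `0` by `1`, harmless because parts are positive,
and gives the form `u + 1` of the moment formulas. -/
theorem scaledBoundary_eq_countP (a : ℝ) {m : ℕ} (p : m.Partition) (x : ℝ) :
    scaledBoundary a p x = a / m * p.parts.countP (⌈a * x⌉₊ - 1 + 1 ≤ ·) := by
  rw [scaledBoundary_eq]
  congr 2
  refine Multiset.countP_congr rfl fun k hk => propext ?_
  have := p.parts_pos hk
  rw [← Nat.ceil_le]
  omega

theorem tendsto_ceil_pred_mul {μ : ℕ → ℝ} (hμ : ∀ᶠ n in atTop, 0 < μ n ∧ μ n < 1)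
    (hμ0 : Tendsto μ atTop (𝓝 0)) {x : ℝ} (hx : 0 ≤ x) :
    Tendsto (fun n => ((⌈1 / μ n * x⌉₊ - 1 : ℕ) : ℝ) * μ n) atTop (𝓝 x) := by
  refine tendsto_of_tendsto_of_tendsto_of_le_of_le'
    (g := fun n => x - μ n) (h := fun _ => x) (by simpa using hμ0.const_sub x)
    tendsto_const_nhds ?_ ?_
  · filter_upwards [hμ] with n hn
    have h1 : 1 / μ n * x ≤ ((⌈1 / μ n * x⌉₊ - 1 : ℕ) : ℝ) + 1 := by
      refine (Nat.le_ceil _).trans ?_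
      exact_mod_cast (by omega : ⌈1 / μ n * x⌉₊ ≤ ⌈1 / μ n * x⌉₊ - 1 + 1)
    have h2 := mul_le_mul_of_nonneg_right h1 hn.1.le
    have h3 : 1 / μ n * x * μ n = x := by field_simp [hn.1.ne']
    linarith
  · filter_upwards [hμ] with n hn
    have hnn : 0 ≤ 1 / μ n * x := mul_nonneg (one_div_pos.2 hn.1).le hx
    have h1 : ((⌈1 / μ n * x⌉₊ - 1 : ℕ) : ℝ) ≤ 1 / μ n * x := by
      rcases Nat.eq_zero_or_pos ⌈1 / μ n * x⌉₊ with h | h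
      · rwa [h, Nat.zero_sub, Nat.cast_zero]
      · rw [Nat.cast_pred h]
        linarith [Nat.ceil_lt_add_one hnn]
    have h2 := mul_le_mul_of_nonneg_right h1 hn.1.le
    have h3 : 1 / μ n * x * μ n = x := by field_simp [hn.1.ne']
    linarith

/-- Squeeze by `exp (-μ / (1 - μ)) ≤ 1 - μ ≤ exp (-μ)`. -/
theorem tendsto_one_sub_pow {μ : ℕ → ℝ} (hμ : ∀ᶠ n in atTop, 0 < μ n ∧ μ n < 1)
    (hμ0 : Tendsto μ atTop (𝓝 0)) {u : ℕ → ℕ} {x : ℝ}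
    (hu : Tendsto (fun n => u n * μ n) atTop (𝓝 x)) :
    Tendsto (fun n => (1 - μ n) ^ u n) atTop (𝓝 (Real.exp (-x))) := by
  have hlow : Tendsto (fun n => Real.exp (-(u n * μ n / (1 - μ n)))) atTop
      (𝓝 (Real.exp (-x))) := by
    have h := hu.div (hμ0.const_sub 1) (by norm_num)
    rw [sub_zero, div_one] at h
    exact (Real.continuous_exp.tendsto _).comp h.neg
  have hup : Tendsto (fun n => Real.exp (-(u n * μ n))) atTop (𝓝 (Real.exp (-x))) :=
    (Real.continuous_exp.tendsto _).comp hu.neg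
  refine tendsto_of_tendsto_of_tendsto_of_le_of_le' hlow hup ?_ ?_
  · filter_upwards [hμ] with n hn
    have h1 : 0 < 1 - μ n := by linarith [hn.2]
    have h2 : Real.exp (-(μ n / (1 - μ n))) ≤ 1 - μ n := by
      rw [Real.exp_neg]
      refine inv_le_of_inv_le₀ h1 ?_
      have h3 := Real.add_one_le_exp (μ n / (1 - μ n))
      have h4 : μ n / (1 - μ n) + 1 = (1 - μ n)⁻¹ := by field_simp; ring
      rwa [h4] at h3
    have h3 : -(u n * μ n / (1 - μ n)) = u n * -(μ n / (1 - μ n)) := by ring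
    rw [h3, Real.exp_nat_mul]
    gcongr
  · filter_upwards [hμ] with n hn
    have h1 : 0 < 1 - μ n := by linarith [hn.2]
    have h2 := Real.add_one_le_exp (-μ n)
    have h3 : -(u n * μ n) = u n * -μ n := by ring
    rw [h3, Real.exp_nat_mul]
    gcongr
    linarith

/-! ### Concentration and the limit shape. -/

/-- The mean square deviation of the scaled boundary at `x` from `exp (-x)` tends to `0`. -/
theorem tendsto_sum_cutWeight_mul_sq {μ : ℕ → ℝ} {m : ℕ → ℕ}
    (hμ : ∀ᶠ n in atTop, 0 < μ n ∧ μ n < 1) (hμ0 : Tendsto μ atTop (𝓝 0))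
    (hm : Tendsto (fun n => μ n * m n) atTop atTop) {x : ℝ} (hx : 0 ≤ x) :
    Tendsto (fun n => ∑ p : (m n).Partition,
      cutWeight (μ n) p * (scaledBoundary (1 / μ n) p x - Real.exp (-x)) ^ 2) atTop (𝓝 0) := by
  set y := Real.exp (-x) with hy
  set u : ℕ → ℕ := fun n => ⌈1 / μ n * x⌉₊ - 1 with hu
  have hux : Tendsto (fun n => u n * μ n) atTop (𝓝 x) := tendsto_ceil_pred_mul hμ hμ0 hx
  have hpow : Tendsto (fun n => (1 - μ n) ^ u n) atTop (𝓝 y) := tendsto_one_sub_pow hμ hμ0 hux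
  have hinv : Tendsto (fun n => (μ n * m n)⁻¹) atTop (𝓝 0) := tendsto_inv_atTop_zero.comp hm
  -- the mean
  set A : ℕ → ℝ := fun n =>
    (1 - μ n) ^ u n * (1 + (1 - u n * μ n - μ n) * (μ n * m n)⁻¹) with hA
  have hAlim : Tendsto A atTop (𝓝 y) := by
    have h := hpow.mul ((((hux.const_sub 1).sub hμ0).mul hinv).const_add 1)
    simpa only [sub_zero, mul_zero, add_zero, mul_one] using h
  -- the bound for the second moment
  set B : ℕ → ℝ := fun n => (1 - μ n) ^ u n * (1 - μ n) ^ u n * (1 + (μ n * m n)⁻¹) ^ 2 +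
    A n * (μ n * m n)⁻¹ with hB
  have hBlim : Tendsto B atTop (𝓝 (y * y)) := by
    have h := ((hpow.mul hpow).mul ((hinv.const_add 1).pow 2)).add (hAlim.mul hinv)
    simpa only [one_pow, mul_zero, add_zero, mul_one] using h
  -- This is the expanded square, with the second moment replaced by its bound `B`.
  have hlim : Tendsto (fun n => B n - 2 * y * A n + y ^ 2) atTop (𝓝 0) := by
    have h := (hBlim.sub (hAlim.const_mul (2 * y))).add_const (y ^ 2)
    have h0 : y * y - 2 * y * y + y ^ 2 = 0 := by ring
    rwa [h0] at h
  refine tendsto_of_tendsto_of_tendsto_of_le_of_le' tendsto_const_nhds hlim ?_ ?_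
  · filter_upwards [hμ] with n hn
    exact Finset.sum_nonneg fun p _ => mul_nonneg (cutWeight_pos hn.1 hn.2 p).le (sq_nonneg _)
  -- Together these give `(u n + 1) * μ n < μ n * m n`, so the exact mean formula applies at level
  -- `m n`.
  have hlarge : ∀ᶠ n in atTop, x + 2 < μ n * m n := hm.eventually_gt_atTop _
  have hsmall : ∀ᶠ n in atTop, u n * μ n < x + 1 := hux.eventually_lt_const (by linarith)
  filter_upwards [hμ, hlarge, hsmall] with n hn hL hS
  obtain ⟨hn0, hn1⟩ := hn
  have hc : 0 < μ n * m n := by linarith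
  have hm0 : (0 : ℝ) < m n := pos_of_mul_pos_right hc hn0.le
  have hum : u n + 1 ≤ m n := by
    have : ((u n + 1 : ℕ) : ℝ) ≤ m n := by
      push_cast
      nlinarith
    exact_mod_cast this
  obtain ⟨k, hk⟩ : ∃ k, m n = k + u n + 1 := ⟨m n - (u n + 1), by omega⟩
  set X : Multiset ℕ → ℝ := fun s => s.countP (u n + 1 ≤ ·) with hX
  have hmean : cutMean (μ n) (m n) X * (μ n * m n)⁻¹ = A n := by
    have h := cutMean_countP hn0 hn1 k (u n)
    rw [← hk] at h
    have hkr : (k : ℝ) = m n - u n - 1 := by rw [hk]; push_cast; ring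
    rw [hX, h, hA, hkr]
    field_simp
    ring
  have hsq : cutMean (μ n) (m n) (fun s => X s ^ 2) * ((μ n * m n)⁻¹) ^ 2 ≤ B n := by
    have h := cutMean_countP_sq_le hn0 hn1 (m n) (u n)
    refine (mul_le_mul_of_nonneg_right h (sq_nonneg _)).trans_eq ?_
    rw [hB]
    simp only [← hmean, hX]
    have h5 : (1 + (m n : ℝ) * μ n) * (μ n * m n)⁻¹ = 1 + (μ n * m n)⁻¹ := by
      field_simp
      ring
    rw [← h5]
    ring
  have hexp : ∑ p : (m n).Partition,
      cutWeight (μ n) p * (scaledBoundary (1 / μ n) p x - y) ^ 2 =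
      cutMean (μ n) (m n) (fun s => X s ^ 2) * ((μ n * m n)⁻¹) ^ 2 -
        2 * y * (cutMean (μ n) (m n) X * (μ n * m n)⁻¹) +
        y ^ 2 * ∑ p : (m n).Partition, cutWeight (μ n) p := by
    simp only [cutMean, Finset.sum_mul, Finset.mul_sum]
    rw [← Finset.sum_sub_distrib, ← Finset.sum_add_distrib]
    refine Finset.sum_congr rfl fun p _ => ?_
    have h6 : 1 / μ n / m n = (μ n * m n)⁻¹ := by field_simp
    rw [scaledBoundary_eq_countP, h6]
    simp only [hX, hu]
    ring
  rw [hexp, hmean, sum_cutWeight hn0 hn1 (by omega)]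
  linarith

open Classical in
-- Chebyshev with a union bound: a bad partition deviates by at least `ε / 3` at some grid point, so
-- its weight is at most the sum of its weighted squared deviations over `(ε / 3) ^ 2`. The level `m
-- n` is kept free to serve both `n` and `n - 1`.
theorem tendsto_sum_cutWeight_filter {μ : ℕ → ℝ} {m : ℕ → ℕ}
    (hμ : ∀ᶠ n in atTop, 0 < μ n ∧ μ n < 1) (hμ0 : Tendsto μ atTop (𝓝 0))
    (hm : Tendsto (fun n => μ n * m n) atTop atTop) {ε : ℝ} (hε : 0 < ε) :
    Tendsto (fun n => ∑ p : (m n).Partition with ∀ x : ℝ, 0 ≤ x →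
      |scaledBoundary (1 / μ n) p x - Real.exp (-x)| < ε, cutWeight (μ n) p) atTop (𝓝 1) := by
  have hδ : 0 < ε / 3 := by positivity
  obtain ⟨K, hK⟩ : ∃ K : ℕ, Real.exp (-(K * (ε / 3))) < ε / 3 := by
    have h : Tendsto (fun K : ℕ => Real.exp (-(K * (ε / 3)))) atTop (𝓝 0) :=
      Real.tendsto_exp_neg_atTop_nhds_zero.comp
        (tendsto_natCast_atTop_atTop.atTop_mul_const hδ)
    exact (h.eventually_lt_const hδ).exists
  have hsum : Tendsto (fun n => 1 - ∑ i ∈ Finset.range (K + 1), (∑ p : (m n).Partition,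
      cutWeight (μ n) p * (scaledBoundary (1 / μ n) p (i * (ε / 3)) -
        Real.exp (-(i * (ε / 3)))) ^ 2) / (ε / 3) ^ 2) atTop (𝓝 1) := by
    have h := (tendsto_finsetSum (Finset.range (K + 1)) fun i _ =>
      (tendsto_sum_cutWeight_mul_sq hμ hμ0 hm (x := i * (ε / 3)) (by positivity)).div_const
        ((ε / 3) ^ 2)).const_sub 1
    simpa using h
  have hm1 : ∀ᶠ n in atTop, 1 ≤ m n := by
    filter_upwards [hm.eventually_gt_atTop 0] with n hn
    by_contra h0
    simp [show m n = 0 by omega] at hn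
  refine tendsto_of_tendsto_of_tendsto_of_le_of_le' hsum tendsto_const_nhds ?_ ?_
  · filter_upwards [hμ, hm1] with n hn hmn
    refine (sub_le_sub_right (sum_cutWeight hn.1 hn.2 hmn).ge _).trans ?_
    rw [Finset.sum_filter]
    simp only [Finset.sum_div]
    rw [Finset.sum_comm, ← Finset.sum_sub_distrib]
    refine Finset.sum_le_sum fun p _ => ?_
    have hw := (cutWeight_pos hn.1 hn.2 p).le
    have ha : 0 ≤ 1 / μ n := (one_div_pos.2 hn.1).le
    have hterm : ∀ i ∈ Finset.range (K + 1), 0 ≤ cutWeight (μ n) p *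
        (scaledBoundary (1 / μ n) p (i * (ε / 3)) - Real.exp (-(i * (ε / 3)))) ^ 2 /
          (ε / 3) ^ 2 := fun i _ => by positivity
    split_ifs with hgood
    · exact sub_le_self _ (Finset.sum_nonneg hterm)
    · have hbad : ∃ i ∈ Finset.range (K + 1),
          ε / 3 ≤ |scaledBoundary (1 / μ n) p (i * (ε / 3)) - Real.exp (-(i * (ε / 3)))| := by
        by_contra! hcon
        exact hgood fun x hx => abs_sub_exp_neg_lt_of_grid hε (scaledBoundary_nonneg ha p)
          (scaledBoundary_antitone ha p) hK hcon hx
      obtain ⟨i, hi, hdev⟩ := hbad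
      refine sub_nonpos.2 (le_trans ?_ (Finset.single_le_sum hterm hi))
      rw [le_div_iff₀ (by positivity), ← sq_abs (_ - _)]
      exact mul_le_mul_of_nonneg_left (pow_le_pow_left₀ hδ.le hdev 2) hw
  · filter_upwards [hμ, hm1] with n hn hmn
    exact (Finset.sum_le_sum_of_subset_of_nonneg (Finset.filter_subset _ _)
      fun p _ _ => (cutWeight_pos hn.1 hn.2 p).le).trans_eq (sum_cutWeight hn.1 hn.2 hmn)

/-- Since `log (μ n * n) → ∞`, dividing the first hypothesis by it leaves `μ n → 0`. -/
theorem tendsto_zero_of_tendsto_mul_log {μ : ℕ → ℝ}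
    (hlog : Tendsto (fun n : ℕ => μ n * Real.log (μ n * n)) atTop (𝓝 0))
    (hinf : Tendsto (fun n : ℕ => μ n * n) atTop atTop) : Tendsto μ atTop (𝓝 0) := by
  have hL : Tendsto (fun n : ℕ => Real.log (μ n * n)) atTop atTop :=
    Real.tendsto_log_atTop.comp hinf
  have h := hlog.mul (tendsto_inv_atTop_zero.comp hL)
  rw [zero_mul] at h
  refine h.congr' ?_
  filter_upwards [hL.eventually_gt_atTop 0] with n hn
  simp [hn.ne']

theorem mainTheorem1 (μ : ℕ → ℝ) (hμ : ∀ n, 2 ≤ n → 0 < μ n ∧ μ n < 1)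
    (hlog : Tendsto (fun n : ℕ => μ n * Real.log (μ n * n)) atTop (𝓝 0))
    (hinf : Tendsto (fun n : ℕ => μ n * n) atTop atTop) :
    -- the process on the partitions of `n`
    (∀ n, 2 ≤ n → ∃! π : n.Partition → ℝ, IsStationaryDistribution (derowRow (μ n) n) π) ∧
    (∀ π : ∀ n : ℕ, n.Partition → ℝ,
      (∀ n, 2 ≤ n → IsStationaryDistribution (derowRow (μ n) n) (π n)) →
      HasLimitShape π (fun n p => scaledBoundary (1 / μ n) p) (fun x => Real.exp (-x))) ∧
    -- the toggling process on the partitions of `n - 1` and of `n`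
    (∀ n, 2 ≤ n → ∃! ρ : (n - 1).Partition ⊕ n.Partition → ℝ,
      IsStationaryDistribution (derowRowToggle (μ n) n) ρ) ∧
    (∀ ρ : ∀ n : ℕ, (n - 1).Partition ⊕ n.Partition → ℝ,
      (∀ n, 2 ≤ n → IsStationaryDistribution (derowRowToggle (μ n) n) (ρ n)) →
      HasLimitShape ρ
        (fun n => Sum.elim (fun p => scaledBoundary (1 / μ n) p)
          (fun p => scaledBoundary (1 / μ n) p))
        (fun x => Real.exp (-x))) := by
  have hμe : ∀ᶠ n in atTop, 0 < μ n ∧ μ n < 1 := eventually_atTop.2 ⟨2, hμ⟩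
  have hμ0 := tendsto_zero_of_tendsto_mul_log hlog hinf
  -- The lower level uses the same `μ n`; passing to `n - 1` loses at most `1`.
  have hinf' : Tendsto (fun n : ℕ => μ n * ((n - 1 : ℕ) : ℝ)) atTop atTop := by
    refine tendsto_atTop_mono' _ ?_ (tendsto_atTop_add_const_right _ (-1) hinf)
    filter_upwards [eventually_ge_atTop 2] with n hn
    rw [Nat.cast_pred (by omega)]
    linarith [(hμ n hn).2]
  refine ⟨fun n hn => ⟨_, isStationaryDistribution_cutWeight (hμ n hn).1 (hμ n hn).2 hn,
    fun _ h => eq_cutWeight_of_isStationaryDistribution (hμ n hn).1 (hμ n hn).2 hn h⟩, ?_,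
    fun n hn => ⟨_, isStationaryDistribution_toggleWeight (hμ n hn).1 (hμ n hn).2 hn,
    fun _ h => eq_toggleWeight_of_isStationaryDistribution (hμ n hn).1 (hμ n hn).2 hn h⟩, ?_⟩
  · intro π hπ ε hε
    refine (tendsto_sum_cutWeight_filter hμe hμ0 hinf hε).congr' ?_
    filter_upwards [eventually_ge_atTop 2] with n hn
    rw [eq_cutWeight_of_isStationaryDistribution (hμ n hn).1 (hμ n hn).2 hn (hπ n hn)]
  · intro ρ hρ ε hε
    have h := ((tendsto_sum_cutWeight_filter hμe hμ0 hinf' hε).div_const 2).add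
      ((tendsto_sum_cutWeight_filter hμe hμ0 hinf hε).div_const 2)
    rw [add_halves] at h
    refine h.congr' ?_
    filter_upwards [eventually_ge_atTop 2] with n hn
    rw [eq_toggleWeight_of_isStationaryDistribution (hμ n hn).1 (hμ n hn).2 hn (hρ n hn)]
    simp only [Finset.sum_filter, Fintype.sum_sum_type, toggleWeight, Sum.elim_inl, Sum.elim_inr,
      Finset.sum_div, ite_div, zero_div]
    rfl
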